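/- Let $q$ be a prime power, $k>1$ an integer, $F=\mathbb F_q$, $L=\mathbb F_{q^{2^k}}\supset F$, and let $M$ be the subfield of $L$ of order $q^{2^{k-1}}$. Represent $\mathrm{PG}(2^k-1,q)$ as the projective space of the $F$-vector space $L$, with points $Fx$, $x\in L\setminus\{0\}$, and let $j(Fx)=Fx^{-1}$. The Desarguesian spread $\mathcal S$ is the set of the projective subspaces with underlying vector spaces $Mz$, $z\in L\setminus\{0\}$. A set of points is scattered with respect to $\mathcal S$ if it meets each element of $\mathcal S$ in at most one point. A line spread is a partition of the point set into lines. A rational curve of order $n$ in $\mathrm{PG}(r,q)$ is a set of points $\{F(g_0(t_0,t_1),\ldots,g_r(t_0,t_1)) : (t_0,t_1)\in F^2\setminus\{(0,0)\}\}$, in some system of homogeneous coordinates, where $g_0,\dots,g_r$ are binary forms of degree $n$ over $F$ with highest common factor $1$; it is normal if it is not the projection, from a point not on it, of a rational curve of order $n$ of $\mathrm{PG}(r+1,q)$ that is not contained in a hyperplane. A normal rational curve of degree $d$ is a normal rational curve whose smallest order is $d$ and whose span has projective dimension $d$. Then there is a line spread $\mathcal F$ of $\mathrm{PG}(2^k-1,q)$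 all of whose lines are scattered with respect to $\mathcal S$. Moreover, for every such line spread $\mathcal F$, the family $\{j(\ell):\ell\in\mathcal F\}$ is a partition of the point set of $\mathrm{PG}(2^k-1,q)$, and 1. if $q\ge 2^k-1$, then each $j(\ell)$, $\ell\in\mathcal F$, is a normal rational curve of degree $2^k-1$; 2. if $q<2^k-1$, then each $j(\ell)$, $\ell\in\mathcal F$, consists of $q+1$ independent points. In particular, $\mathrm{PG}(2^k-1,q)$ has a partition into normal rational curves of degree $2^k-1$ if $q\ge 2^k-1$, and a partition into $(q+1)$-tuples of independent points if $q<2^k-1$. -/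

import Mathlib

open scoped LinearAlgebra.Projectivization

namespace FieldInversion

section General

variable {F V : Type*} [Field F] [AddCommGroup V] [Module F V]

/-- The set of points of the projective subspace given by a linear subspace `W`. -/
def pointsOf (W : Submodule F V) : Set (ℙ F V) :=
  {P | P.submodule ≤ W}

/-- A line of the projective space of `V`, as a set of points. -/
def IsLine (l : Set (ℙ F V)) : Prop :=
  ∃ W : Submodule F V, Module.finrank F W = 2 ∧ l = pointsOf W

/-- A line spread: a set of lines such that every point lies on exactly one of them. -/
def IsLineSpread (S : Set (Set (ℙ F V))) : Prop :=
  (∀ l ∈ S, IsLine l) ∧ Setoid.IsPartition S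

/-- A set of points is scattered with respect to a spread if it meets every element of the
spread in at most one point. -/
def IsScattered (A : Set (ℙ F V)) (S : Set (Set (ℙ F V))) : Prop :=
  ∀ B ∈ S, (A ∩ B).Subsingleton

/-- The linear subspace spanned by a set of points. -/
def pointSpan (C : Set (ℙ F V)) : Submodule F V :=
  ⨆ P ∈ C, P.submodule

/-- `C` is a rational curve of order `n`: in some system of homogeneous coordinates it is the set
of the points `F (g₀(t₀, t₁), …, gᵣ(t₀, t₁))` for binary forms `gᵢ` of degree `n`
without nonconstant common factor. -/
def IsRationalCurve (n : ℕ) (C : Set (ℙ F V)) : Prop :=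
  ∃ (r : ℕ) (b : Module.Basis (Fin (r + 1)) F V) (g : Fin (r + 1) → MvPolynomial (Fin 2) F),
    (∀ i, (g i).IsHomogeneous n) ∧
    (∀ p : MvPolynomial (Fin 2) F, (∀ i, p ∣ g i) → IsUnit p) ∧
    C = {P | ∃ t : Fin 2 → F, t ≠ 0 ∧
      P.submodule = Submodule.span F {∑ i, MvPolynomial.eval t (g i) • b i}}

/-- `C` is the projection, from a point not on `C'`, of a set of points `C'` of a projective space
of dimension one more. The centre is the kernel of `π`. -/
def IsProjectionOf {V' : Type*} [AddCommGroup V'] [Module F V']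
    (C : Set (ℙ F V)) (C' : Set (ℙ F V')) : Prop :=
  ∃ π : V' →ₗ[F] V, Function.Surjective π ∧ Module.finrank F (LinearMap.ker π) = 1 ∧
    (∀ P' ∈ C', P'.submodule ≠ LinearMap.ker π) ∧
    C = {P | ∃ P' ∈ C', P.submodule = P'.submodule.map π}

/-- A rational curve `C` of order `n` is normal if it is not the projection of a rational curve of
the same order that lies in a projective space of dimension one more and spans it. -/
def IsNormalRationalCurve (n : ℕ) (C : Set (ℙ F V)) : Prop :=
  IsRationalCurve n C ∧
    ¬ ∃ C' : Set (ℙ F (Fin (Module.finrank F V + 1) → F)),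
      IsRationalCurve n C' ∧ pointSpan C' = ⊤ ∧ IsProjectionOf C C'

/-- A normal rational curve of degree `d`: `d` is the smallest of its orders and is the projective
dimension of its span. -/
def IsNRCOfDegree (d : ℕ) (C : Set (ℙ F V)) : Prop :=
  IsLeast {n | IsNormalRationalCurve n C} d ∧ Module.finrank F (pointSpan C) = d + 1

/-- `C` consists of `m` independent points. -/
def IsIndependentTuple (m : ℕ) (C : Set (ℙ F V)) : Prop :=
  C.ncard = m ∧ Projectivization.Independent (fun P : C => (P : ℙ F V))

end General

section Extension

variable {F L : Type*} [Field F] [Field L] [Algebra F L]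

/-- The inversion map `F x ↦ F x⁻¹` on the points of the projective space of `L` over `F`. -/
def inversion : ℙ F L → ℙ F L :=
  Projectivization.lift
    (fun x : {v : L // v ≠ 0} => Projectivization.mk F (x : L)⁻¹ (inv_ne_zero x.2)) (by
      intro a b t hab
      have ht : t ≠ 0 := by
        rintro rfl
        exact a.2 (by simpa using hab)
      refine (Projectivization.mk_eq_mk_iff' F _ _ _ _).2 ⟨t⁻¹, ?_⟩
      simp only [hab, Algebra.smul_def, mul_inv, map_inv₀])

/-- The defining formula of the inversion map. -/
theorem inversion_mk (x : L) (hx : x ≠ 0) :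
    inversion (Projectivization.mk F x hx) = Projectivization.mk F x⁻¹ (inv_ne_zero hx) :=
  rfl

/-- The Desarguesian spread of an intermediate field `M`: its elements are the projective
subspaces over `F` that underlie the one-dimensional `M`-subspaces `M z` of `L`, for `z ≠ 0`. -/
def desarguesianSpread (M : IntermediateField F L) : Set (Set (ℙ F L)) :=
  {S | ∃ z : L, z ≠ 0 ∧ S = pointsOf ((Submodule.span M {z}).restrictScalars F)}

/-- The images under the inversion map of the members of a family of point sets. -/
def inversionImage (S : Set (Set (ℙ F L))) : Set (Set (ℙ F L)) :=
  (fun l => inversion '' l) '' S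

end Extension

end FieldInversion

/-! Let `ℓ` be the line spanned by `a`, `b`, put `θ = b / a` and let `f` be the minimal polynomial
of `θ` over `F`. If `ℓ` is scattered then `θ ∉ M`, and since the degree of `L` is a power of two
this forces `F(θ) = L`. For `s ∈ F`, `f(s) (s a - b)⁻¹ = a⁻¹ f(s) / (s - θ)` is a polynomial in `s`
whose coefficients are `a⁻¹` times those of `f / (X - θ)`, a basis of `L`; the point `F a` supplies
`s = ∞`. Hence `j(ℓ)` is a moment curve (`exists_inversion_image_eq_momentCurve`). Vandermonde
determinants then show that its points span `L` when `q ≥ 2^k - 1` and are independent when `q ≤ 2^k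
- 1`.

A scattered spread is built by induction along the tower of quadratic extensions
(`IsScatteredSpread.extend`). With `σ` an involution of `M` and `M₀` its fixed field, an `F`-linear
bijection `M × M → L` twisted by `σ` sends each `M`-line to a subspace on which multiplication by `m
∈ M` can move a nonzero vector to another vector only if `m ∈ M₀`. Filling each image with a copy of
a spread of `M` scattered over `M₀` gives one of `L` scattered over `M`. -/

namespace FieldInversion

/-! ### Existence of scattered line spreads. -/

section ScatteredSpread

/-- A spread of two-dimensional `F`-subspaces of `L`, each of which meets every one-dimensional
`M`-subspace in an `F`-subspace of dimension at most one. -/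
def IsScatteredSpread {F L : Type*} [Field F] [Field L] [Algebra F L] (M : IntermediateField F L)
    (S : Set (Submodule F L)) : Prop :=
  (∀ W ∈ S, Module.finrank F W = 2) ∧
  (∀ W ∈ S, ∀ x ∈ W, x ≠ 0 → ∀ m ∈ M, m * x ∈ W → m ∈ (⊥ : IntermediateField F L)) ∧
  ∀ x : L, x ≠ 0 → ∃! W, W ∈ S ∧ x ∈ W

/-- A twisted multiplication on `M × M` shares with the ordinary scalar action only the scalars
fixed by `σ`. -/
theorem eq_of_twisted_eq {M : Type*} [Field M] {σ : M →+* M} (hσ : ∀ x, σ (σ x) = x) {κ : M}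
    (hκ : κ ≠ σ κ) (hκ' : κ + σ κ ≠ 0) {m r a b : M} (hab : a ≠ 0 ∨ b ≠ 0)
    (h₁ : m * (a + σ b) = r * a + σ (r * b))
    (h₂ : m * (κ * b + σ κ * σ a) = κ * (r * b) + σ κ * σ (r * a)) :
    m = r ∧ σ m = m := by
  have hκ0 : κ ≠ 0 := by rintro rfl; simp at hκ
  simp only [map_mul] at h₁ h₂
  have e₁ : (m - r) * a + (m - σ r) * σ b = 0 := by linear_combination h₁
  have e₂ : (m - r) * (κ * b) + (m - σ r) * (σ κ * σ a) = 0 := by linear_combination h₂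
  have key : m = r ∧ m = σ r := by
    by_cases hmr : m = r
    · refine ⟨hmr, ?_⟩
      by_contra hms
      have hms' := sub_ne_zero.2 hms
      simp only [hmr, sub_self, zero_mul, zero_add] at e₁ e₂ hms'
      simp [hms', hκ0] at e₁ e₂
      tauto
    by_cases hms : m = σ r
    · exfalso
      have hmr' := sub_ne_zero.2 hmr
      rw [← hms] at e₁ e₂
      simp [hmr', hκ0] at e₁ e₂
      tauto
    exfalso
    have hmr' := sub_ne_zero.2 hmr
    have hms' := sub_ne_zero.2 hms
    -- The equations `e₁`, `e₂` are linear in `m - r` and `m - σ r`, so a solution with both nonzero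
    -- makes the determinant vanish. Applying `σ` exchanges `κ` and `σ κ`; the sum of the two
    -- relations equates the norms `a * σ a` and `b * σ b`, and `κ ≠ σ κ` then makes them zero.
    have hdet : σ κ * (a * σ a) = κ * (b * σ b) := by
      apply mul_left_cancel₀ hmr'
      apply mul_left_cancel₀ hms'
      linear_combination (m - σ r) * σ κ * σ a * e₁ - (m - σ r) * σ b * e₂
    have hdet' : κ * (a * σ a) = σ κ * (b * σ b) := by
      have := congrArg σ hdet
      simp only [map_mul, hσ] at this
      linear_combination this
    have hN : a * σ a = b * σ b := by
      apply mul_left_cancel₀ hκ'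
      linear_combination hdet + hdet'
    have hN0 : a * σ a = 0 := by
      apply mul_left_cancel₀ (sub_ne_zero.2 hκ)
      rw [← hN] at hdet
      linear_combination -hdet
    have hN1 : b * σ b = 0 := hN ▸ hN0
    simp only [mul_eq_zero, map_eq_zero, or_self] at hN0 hN1
    tauto
  exact ⟨key.1, (congrArg σ key.1).trans key.2.symm⟩

/-- An element not fixed by an involution and with non-zero trace. -/
theorem exists_ne_and_add_ne_zero {M : Type*} [Field M] {σ : M →+* M} (h : σ ≠ RingHom.id M) :
    ∃ κ : M, κ ≠ σ κ ∧ κ + σ κ ≠ 0 := by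
  obtain ⟨κ, hκ⟩ : ∃ κ, κ ≠ σ κ := by
    by_contra! hc
    exact h (RingHom.ext fun x => (hc x).symm)
  by_cases h0 : κ + σ κ = 0
  -- The trace of `κ + 1` is `2`; if that vanishes, trace zero for `κ` already means `κ = σ κ`.
  · refine ⟨κ + 1, by simpa using hκ, fun h1 => hκ ?_⟩
    have h2 : (2 : M) = 0 := by
      simp only [map_add, map_one] at h1
      linear_combination h1 - h0
    linear_combination h0 - σ κ * h2
  · exact ⟨κ, hκ, h0⟩

/-- Extending a scattered spread along a quadratic extension. -/
theorem IsScatteredSpread.extend {F L : Type*} [Field F] [Field L] [Algebra F L]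
    [FiniteDimensional F L] {M : IntermediateField F L} (hM : Module.finrank M L = 2)
    {M₀ : IntermediateField F M} {σ : M →ₐ[F] M} (hσ : ∀ x, σ (σ x) = x)
    (hσ1 : σ ≠ AlgHom.id F M) (hσ0 : ∀ x, σ x = x → x ∈ M₀)
    {S₀ : Set (Submodule F M)} (hS₀ : IsScatteredSpread M₀ S₀) :
    ∃ S : Set (Submodule F L), IsScatteredSpread M S := by
  obtain ⟨hS2, hSs, hSp⟩ := hS₀
  obtain ⟨κ, hκ, hκ'⟩ := exists_ne_and_add_ne_zero (σ := (σ : M →+* M))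
    (fun h => hσ1 (AlgHom.ext fun x => RingHom.congr_fun h x))
  have hκ : κ ≠ σ κ := hκ
  have hκ' : κ + σ κ ≠ 0 := hκ'
  let e : (Fin 2 → M) ≃ₗ[M] L := ((Module.finBasisOfFinrankEq M L hM).equivFun).symm
  let e' : (Fin 2 → M) ≃ₗ[F] L := e.restrictScalars F
  -- The twist: `ψ₀` commutes with scalars fixed by `σ`, and `key` below shows that it respects no
  -- others, even on a single nonzero vector.
  let ψ₀ : M × M →ₗ[F] (Fin 2 → M) := LinearMap.pi
    ![LinearMap.fst F M M + σ.toLinearMap ∘ₗ LinearMap.snd F M M,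
      LinearMap.mulLeft F κ ∘ₗ LinearMap.snd F M M +
        LinearMap.mulLeft F (σ κ) ∘ₗ σ.toLinearMap ∘ₗ LinearMap.fst F M M]
  have hψ₀ : ∀ p, ψ₀ p = ![p.1 + σ p.2, κ * p.2 + σ κ * σ p.1] := by
    intro p
    ext i
    fin_cases i <;> simp [ψ₀]
  have hinj₀ : Function.Injective ψ₀ := by
    rw [← LinearMap.ker_eq_bot, LinearMap.ker_eq_bot']
    rintro ⟨a, b⟩ h
    rw [hψ₀] at h
    have h1 : a + σ b = 0 := congrFun h 0
    have h2 : κ * b + σ κ * σ a = 0 := congrFun h 1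
    by_contra hne
    have hab : a ≠ 0 ∨ b ≠ 0 := by
      by_contra! hc
      exact hne (by rw [hc.1, hc.2]; rfl)
    have h3 : σ a + b = 0 := by simpa [hσ] using congrArg σ h1
    have h4 : (κ - σ κ) * b = 0 := by linear_combination h2 - σ κ * h3
    have hb : b = 0 := by simpa [sub_ne_zero.2 hκ] using h4
    subst hb
    simp at h1 hab
    exact hab h1
  let ψ : M × M →ₗ[F] L := e'.toLinearMap ∘ₗ ψ₀
  have hinj : Function.Injective ψ := e'.injective.comp hinj₀
  have hsurj : Function.Surjective ψ := by
    refine (LinearMap.injective_iff_surjective_of_finrank_eq_finrank ?_).1 hinj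
    rw [← e'.finrank_eq, Module.finrank_prod, Module.finrank_pi_fintype]
    simp [two_mul]
  have key : ∀ (m : M) (r a b : M), (a ≠ 0 ∨ b ≠ 0) →
      (m : L) * ψ (a, b) = ψ (r * a, r * b) → m = r ∧ σ m = m := by
    intro m r a b hab h
    have h' : m • ψ₀ (a, b) = ψ₀ (r * a, r * b) := by
      apply e.injective
      rw [map_smul]
      exact h
    rw [hψ₀, hψ₀] at h'
    exact eq_of_twisted_eq (σ := (σ : M →+* M)) hσ hκ hκ' hab
      (by simpa using congrFun h' 0) (by simpa using congrFun h' 1)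
  -- One direction vector for each `M`-line of `M × M`; `none` is the vertical one.
  let v : Option M → M × M := fun o => o.elim (0, 1) (fun b => (1, b))
  have hv0 : ∀ o, (v o).1 ≠ 0 ∨ (v o).2 ≠ 0 := by
    rintro (_ | b) <;> simp [v]
  let ι : Option M → M →ₗ[F] L := fun o =>
    ψ ∘ₗ (LinearMap.mulRight F (v o).1).prod (LinearMap.mulRight F (v o).2)
  have hι : ∀ o c, ι o c = ψ (c * (v o).1, c * (v o).2) := fun _ _ => rfl
  have hιinj : ∀ o, Function.Injective (ι o) := by
    intro o c d h
    rw [hι, hι] at h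
    have h' := hinj h
    rw [Prod.mk.injEq] at h'
    rcases hv0 o with h0 | h0
    · exact mul_right_cancel₀ h0 h'.1
    · exact mul_right_cancel₀ h0 h'.2
  refine ⟨{W | ∃ o, ∃ W₀ ∈ S₀, W = W₀.map (ι o)}, ?_, ?_, ?_⟩
  · rintro W ⟨o, W₀, hW₀, rfl⟩
    rw [← hS2 W₀ hW₀]
    exact (Submodule.equivMapOfInjective _ (hιinj o) W₀).finrank_eq.symm
  · rintro W ⟨o, W₀, hW₀, rfl⟩ x ⟨c, hc, rfl⟩ hx m hm hmx
    obtain ⟨d, hd, hdx⟩ := hmx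
    have hc0 : c ≠ 0 := by
      rintro rfl
      simp at hx
    -- Here `x` and `m * x` are the images of `c` and `d`, so multiplication by `m` corresponds to
    -- multiplication by `d / c` in `M`.
    obtain ⟨h1, h2⟩ := key ⟨m, hm⟩ (d / c) (c * (v o).1) (c * (v o).2)
      ((hv0 o).imp (mul_ne_zero hc0) (mul_ne_zero hc0)) (by
        rw [← hι, ← mul_assoc, ← mul_assoc, div_mul_cancel₀ _ hc0, ← hι, hdx])
    have h3 := hSs W₀ hW₀ c hc hc0 ⟨m, hm⟩ (hσ0 _ h2) (by
      rw [h1, div_mul_cancel₀ _ hc0]; exact hd)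
    obtain ⟨f, hf⟩ := IntermediateField.mem_bot.1 h3
    exact IntermediateField.mem_bot.2 ⟨f, by simpa using congrArg (algebraMap M L) hf⟩
  · intro x hx
    obtain ⟨⟨a, b⟩, rfl⟩ := hsurj x
    have hex : ∃ o c, c ≠ 0 ∧ (a, b) = (c * (v o).1, c * (v o).2) := by
      by_cases ha : a = 0
      · refine ⟨none, b, ?_, by simp [v, ha]⟩
        rintro rfl
        exact hx (by rw [ha]; exact map_zero ψ)
      · exact ⟨some (b / a), a, ha, by simp [v, mul_div_cancel₀ _ ha]⟩
    obtain ⟨o, c, hc, habc⟩ := hex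
    obtain ⟨W₀, ⟨hW₀, hcW⟩, huniq⟩ := hSp c hc
    rw [habc, ← hι]
    refine ⟨W₀.map (ι o), ⟨⟨o, W₀, hW₀, rfl⟩, c, hcW, rfl⟩, ?_⟩
    rintro _ ⟨⟨o', W₁, hW₁, rfl⟩, d, hd, hdx⟩
    rw [hι, hι] at hdx
    have hdx := hinj hdx
    rw [Prod.mk.injEq] at hdx
    have hoo : o' = o ∧ d = c := by
      obtain ⟨h1, h2⟩ := hdx
      clear_value ψ
      rcases o' with _ | b' <;> rcases o with _ | b''
      · simpa [v] using h2
      · simp only [v, Option.elim, mul_zero, mul_one] at h1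
        exact absurd h1.symm hc
      · simp only [v, Option.elim, mul_zero, mul_one] at h1 h2
        subst h1
        rw [zero_mul] at h2
        exact absurd h2.symm hc
      · simp only [v, Option.elim, mul_one] at h1 h2
        subst h1
        exact ⟨congrArg some (mul_left_cancel₀ hc h2), rfl⟩
    obtain ⟨rfl, rfl⟩ := hoo
    rw [huniq W₁ ⟨hW₁, hd⟩]

/-- The exponents are shifted so that the base case is `M = F`, where `L` is itself a single line.
-/
theorem exists_isScatteredSpread {F : Type*} [Field F] [Finite F] (k : ℕ) :
    ∀ {L : Type*} [Field L] [Algebra F L], Module.finrank F L = 2 ^ (k + 1) →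
      ∀ M : IntermediateField F L, Module.finrank F M = 2 ^ k →
        ∃ S : Set (Submodule F L), IsScatteredSpread M S := by
  induction k with
  | zero =>
    intro L _ _ hL M hM
    have : M = ⊥ := IntermediateField.finrank_eq_one_iff.1 (by simpa using hM)
    subst this
    exact ⟨{⊤}, by simp [hL], fun _ _ _ _ _ m hm _ => hm, fun x _ => ⟨⊤, by simp, by simp⟩⟩
  | succ k ih =>
    intro L _ _ hL M hM
    have : FiniteDimensional F L := Module.finite_of_finrank_pos (by rw [hL]; positivity)
    have : Finite L := Module.finite_of_finite F
    have hML : Module.finrank M L = 2 := by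
      have h := Module.finrank_mul_finrank F M L
      rw [hM, hL, pow_succ 2 (k + 1)] at h
      exact Nat.eq_of_mul_eq_mul_left (by positivity) h
    have hcard : Nat.card Gal(M/F) = 2 ^ (k + 1) := by
      rw [IsGalois.card_aut_eq_finrank, hM]
    -- Cauchy's theorem gives the involution; its fixed field is the `M₀` of the inductive step.
    obtain ⟨σ, hσ⟩ := exists_prime_orderOf_dvd_card' (G := Gal(M/F)) 2
      (by rw [hcard, pow_succ]; exact dvd_mul_left _ _)
    let H := Subgroup.zpowers σ
    have hH : Module.finrank (IntermediateField.fixedField H) M = 2 := by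
      rw [IntermediateField.finrank_fixedField_eq_card, Nat.card_zpowers, hσ]
    have hM₀ : Module.finrank F (IntermediateField.fixedField H) = 2 ^ k := by
      have h := Module.finrank_mul_finrank F (IntermediateField.fixedField H) M
      rw [hH, hM, pow_succ] at h
      exact Nat.eq_of_mul_eq_mul_right (by positivity) h
    obtain ⟨S₀, hS₀⟩ := ih hM _ hM₀
    have hσ2 : ∀ x, σ (σ x) = x := by
      intro x
      have := congrArg (fun τ : Gal(M/F) => τ x) (hσ ▸ pow_orderOf_eq_one σ)
      simpa [pow_two] using this
    refine IsScatteredSpread.extend hML (σ := (σ : M →ₐ[F] M)) hσ2 ?_ ?_ hS₀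
    · intro h
      have : σ = 1 := AlgEquiv.ext fun x => AlgHom.congr_fun h x
      rw [this] at hσ
      simp at hσ
    · intro x hx
      rw [IntermediateField.mem_fixedField_iff]
      have hle : H ≤ MulAction.stabilizer Gal(M/F) x := by
        rw [Subgroup.zpowers_le]
        exact hx
      exact fun f hf => hle hf

end ScatteredSpread

/-! ### Rational curves and moment curves. -/

section RationalCurves

variable {F V : Type*} [Field F] [AddCommGroup V] [Module F V]

/-- The monomial `X₀ ^ j * X₁ ^ (n - j)` as an exponent vector. -/
noncomputable def binaryExponent (n j : ℕ) : Fin 2 →₀ ℕ :=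
  Finsupp.single 0 j + Finsupp.single 1 (n - j)

theorem binaryExponent_zero (n j : ℕ) : binaryExponent n j 0 = j := by
  simp [binaryExponent]

theorem binaryExponent_one (n j : ℕ) : binaryExponent n j 1 = n - j := by
  simp [binaryExponent]

/-- A binary form is a combination of the monomials of its degree. -/
theorem eval_eq_sum_of_isHomogeneous {n : ℕ} {g : MvPolynomial (Fin 2) F} (hg : g.IsHomogeneous n)
    (t : Fin 2 → F) :
    MvPolynomial.eval t g = ∑ j : Fin (n + 1),
      MvPolynomial.coeff (binaryExponent n j) g * (t 0 ^ (j : ℕ) * t 1 ^ (n - j)) := by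
  have hinj : Function.Injective fun j : Fin (n + 1) => binaryExponent n j := by
    intro i j h
    have := DFunLike.congr_fun h 0
    simpa only [binaryExponent_zero, Fin.val_inj] using this
  rw [MvPolynomial.eval_eq']
  have h : ∑ j : Fin (n + 1),
      MvPolynomial.coeff (binaryExponent n j) g * (t 0 ^ (j : ℕ) * t 1 ^ (n - j)) =
      ∑ d ∈ Finset.univ.map ⟨_, hinj⟩, MvPolynomial.coeff d g * ∏ i, t i ^ d i := by
    rw [Finset.sum_map]
    simp [binaryExponent_zero, binaryExponent_one]
  rw [h]
  refine Finset.sum_subset (fun d hd => ?_) (fun d _ hd => ?_)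
  · have hdeg := hg (MvPolynomial.mem_support_iff.1 hd)
    replace hdeg : d.degree = n := by rwa [Finsupp.degree_eq_weight_one]
    rw [Finsupp.degree_eq_sum, Fin.sum_univ_two] at hdeg
    refine Finset.mem_map.2 ⟨⟨d 0, by omega⟩, Finset.mem_univ _, ?_⟩
    ext i
    fin_cases i
    · simp [binaryExponent_zero]
    · simp [binaryExponent_one]
      omega
  · rw [MvPolynomial.notMem_support_iff.1 hd, zero_mul]

/-- The span of a rational curve of order `n` has projective dimension at most `n`. -/
theorem finrank_pointSpan_le_of_isRationalCurve {n : ℕ} {C : Set (ℙ F V)}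
    (hC : IsRationalCurve n C) : Module.finrank F (pointSpan C) ≤ n + 1 := by
  obtain ⟨r, b, g, hg, -, rfl⟩ := hC
  let w : Fin (n + 1) → V := fun j => ∑ i, MvPolynomial.coeff (binaryExponent n j) (g i) • b i
  have hle : pointSpan {P : ℙ F V | ∃ t : Fin 2 → F, t ≠ 0 ∧
      P.submodule = Submodule.span F {∑ i, MvPolynomial.eval t (g i) • b i}} ≤
      Submodule.span F (Set.range w) := by
    refine iSup₂_le fun P hP => ?_
    obtain ⟨t, -, ht⟩ := hP
    rw [ht, Submodule.span_singleton_le_iff_mem]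
    have : ∑ i, MvPolynomial.eval t (g i) • b i =
        ∑ j : Fin (n + 1), (t 0 ^ (j : ℕ) * t 1 ^ (n - j)) • w j := by
      simp only [w, Finset.smul_sum, eval_eq_sum_of_isHomogeneous (hg _), Finset.sum_smul]
      rw [Finset.sum_comm]
      refine Finset.sum_congr rfl fun j _ => Finset.sum_congr rfl fun i _ => ?_
      rw [smul_smul, mul_comm]
    rw [this]
    exact Submodule.sum_mem _ fun j _ =>
      Submodule.smul_mem _ _ (Submodule.subset_span (Set.mem_range_self j))
  calc _ ≤ Module.finrank F (Submodule.span F (Set.range w)) := by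
        have := Module.Finite.span_of_finite F (Set.finite_range w)
        exact Submodule.finrank_mono hle
    _ ≤ n + 1 := by
        exact (finrank_range_le_card (R := F) w).trans_eq (Fintype.card_fin _)

/-- A rational curve of order `d` that spans a space of projective dimension `d` is a normal
rational curve of degree `d`. -/
theorem isNRCOfDegree_of_pointSpan_eq_top {d : ℕ} {C : Set (ℙ F V)}
    (hV : Module.finrank F V = d + 1) (hC : IsRationalCurve d C) (hspan : pointSpan C = ⊤) :
    IsNRCOfDegree d C := by
  have hfin : Module.finrank F (pointSpan C) = d + 1 := by rw [hspan, finrank_top, hV]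
  refine ⟨⟨⟨hC, ?_⟩, ?_⟩, hfin⟩
  -- A spanning `C'` would need a span of rank `d + 2`, while order `d` allows only `d + 1`.
  · rintro ⟨C', hC', htop, -⟩
    have h := finrank_pointSpan_le_of_isRationalCurve hC'
    rw [htop, finrank_top, Module.finrank_fin_fun, hV] at h
    omega
  · intro m hm
    have h := finrank_pointSpan_le_of_isRationalCurve hm.1
    omega

/-- The vectors on the affine cone of the moment curve of a basis, parametrized by `F ∪ {∞}`. -/
noncomputable def momentVector {d : ℕ} (b : Module.Basis (Fin (d + 1)) F V) (o : Option F) : V :=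
  o.elim (b (Fin.last d)) fun s => ∑ i : Fin (d + 1), s ^ (i : ℕ) • b i

theorem repr_momentVector_some {d : ℕ} (b : Module.Basis (Fin (d + 1)) F V) (s : F)
    (i : Fin (d + 1)) : b.repr (momentVector b (some s)) i = s ^ (i : ℕ) := by
  simp [momentVector, Finsupp.single_apply]

theorem repr_momentVector_none {d : ℕ} (b : Module.Basis (Fin (d + 1)) F V)
    (i : Fin (d + 1)) : b.repr (momentVector b none) i = if i = Fin.last d then 1 else 0 := by
  simp [momentVector, Finsupp.single_apply, eq_comm]

theorem momentVector_ne_zero {d : ℕ} (b : Module.Basis (Fin (d + 1)) F V) (o : Option F) :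
    momentVector b o ≠ 0 := by
  intro h
  rcases o with _ | s
  · have := repr_momentVector_none b (Fin.last d)
    simp [h] at this
  · have := repr_momentVector_some b s 0
    simp [h] at this

/-- The moment curve of a basis. -/
def momentCurve {d : ℕ} (b : Module.Basis (Fin (d + 1)) F V) : Set (ℙ F V) :=
  Set.range fun o => Projectivization.mk F (momentVector b o) (momentVector_ne_zero b o)

theorem submodule_eq_span_iff {P : ℙ F V} {v : V} (hv : v ≠ 0) :
    P.submodule = Submodule.span F {v} ↔ P = Projectivization.mk F v hv := by
  rw [← Projectivization.submodule_mk v hv, Projectivization.submodule_injective.eq_iff]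

theorem mk_smul_eq_mk {v : V} {c : F} (hv : v ≠ 0) (h : c • v ≠ 0) :
    Projectivization.mk F (c • v) h = Projectivization.mk F v hv :=
  (Projectivization.mk_eq_mk_iff' F _ _ _ _).2 ⟨c, rfl⟩

theorem isRationalCurve_momentCurve {d : ℕ} (b : Module.Basis (Fin (d + 1)) F V) :
    IsRationalCurve d (momentCurve b) := by
  let g : Fin (d + 1) → MvPolynomial (Fin 2) F := fun i =>
    MvPolynomial.X 0 ^ (i : ℕ) * MvPolynomial.X 1 ^ (d - i)
  have hzero : ∀ t : Fin 2 → F, t 1 = 0 →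
      ∑ i, MvPolynomial.eval t (g i) • b i = t 0 ^ d • momentVector b none := by
    intro t ht
    rw [Finset.sum_eq_single (Fin.last d)]
    · simp [g, momentVector]
    · intro i _ hi
      have : d - (i : ℕ) ≠ 0 := by
        have := Fin.val_lt_last hi
        omega
      simp [g, ht, this]
    · simp
  have hone : ∀ t : Fin 2 → F, t 1 ≠ 0 →
      ∑ i, MvPolynomial.eval t (g i) • b i = t 1 ^ d • momentVector b (some (t 0 / t 1)) := by
    intro t ht
    simp only [momentVector, Option.elim, Finset.smul_sum]
    refine Finset.sum_congr rfl fun i _ => ?_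
    rw [smul_smul]
    congr 1
    simp only [g, map_mul, map_pow, MvPolynomial.eval_X]
    rw [div_pow, ← pow_sub_mul_pow (t 1) (Nat.lt_succ_iff.1 i.2)]
    field_simp
  refine ⟨d, b, g, fun i => ?_, fun p hp => ?_, ?_⟩
  · have h := (MvPolynomial.isHomogeneous_X_pow (R := F) (0 : Fin 2) i).mul
      (MvPolynomial.isHomogeneous_X_pow (R := F) (1 : Fin 2) (d - i))
    rwa [Nat.add_sub_cancel' (Nat.lt_succ_iff.1 i.2)] at h
  · have h0 : p ∣ MvPolynomial.X 0 ^ d := by simpa [g] using hp (Fin.last d)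
    have h1 : p ∣ MvPolynomial.X 1 ^ d := by simpa [g] using hp 0
    have hrel : IsRelPrime (MvPolynomial.X 0 : MvPolynomial (Fin 2) F) (MvPolynomial.X 1) := by
      rw [(MvPolynomial.X_prime (R := F) (i := (0 : Fin 2))).irreducible.isRelPrime_iff_not_dvd,
        MvPolynomial.X_dvd_X]
      simp
    exact (hrel.pow) h0 h1
  · ext P
    constructor
    · rintro ⟨_ | s, rfl⟩
      · refine ⟨![1, 0], by simp, ?_⟩
        rw [hzero _ (by simp)]
        simp [Projectivization.submodule_mk]
      · refine ⟨![s, 1], by simp, ?_⟩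
        rw [hone _ (by simp)]
        simp [Projectivization.submodule_mk]
    · rintro ⟨t, ht, hP⟩
      by_cases h1 : t 1 = 0
      · have h0 : t 0 ^ d ≠ 0 := by
          refine pow_ne_zero _ fun h0 => ht ?_
          ext i
          fin_cases i <;> assumption
        rw [hzero t h1, submodule_eq_span_iff (smul_ne_zero h0 (momentVector_ne_zero b _))] at hP
        exact ⟨none, by rw [hP, mk_smul_eq_mk]⟩
      · rw [hone t h1, submodule_eq_span_iff
          (smul_ne_zero (pow_ne_zero d h1) (momentVector_ne_zero b _))] at hP
        exact ⟨some (t 0 / t 1), by rw [hP, mk_smul_eq_mk]⟩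

theorem pointSpan_momentCurve {d : ℕ} (b : Module.Basis (Fin (d + 1)) F V) :
    pointSpan (momentCurve b) = Submodule.span F (Set.range (momentVector b)) := by
  rw [pointSpan, momentCurve, iSup_range, Submodule.span_range_eq_iSup]
  simp only [Projectivization.submodule_mk]

/-- The moment curve spans the whole space if the field is not too small. -/
theorem pointSpan_momentCurve_eq_top [Finite F] {d : ℕ} (b : Module.Basis (Fin (d + 1)) F V)
    (hd : d ≤ Nat.card F) : pointSpan (momentCurve b) = ⊤ := by
  rw [pointSpan_momentCurve]
  by_contra hne
  obtain ⟨f, hf0, hf⟩ := Submodule.exists_le_ker_of_lt_top _ (lt_top_iff_ne_top.2 hne)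
  have hv : ∀ o, f (momentVector b o) = 0 := fun o =>
    hf (Submodule.subset_span (Set.mem_range_self o))
  have hlast : f (b (Fin.last d)) = 0 := hv none
  have := Fintype.ofFinite F
  obtain ⟨e⟩ : Nonempty (Fin d ↪ F) := by
    rw [Function.Embedding.nonempty_iff_card_le, Fintype.card_fin, ← Nat.card_eq_fintype_card]
    exact hd
  -- The point at infinity kills the top coefficient, leaving a polynomial of degree less than `d`
  -- with `d` distinct zeros; this is why `d ≤ q` suffices.
  have hz : (fun i : Fin d => f (b i.castSucc)) = 0 := by
    refine Matrix.eq_zero_of_forall_index_sum_pow_mul_eq_zero e.injective fun j => ?_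
    have h := hv (some (e j))
    simpa [momentVector, Fin.sum_univ_castSucc, hlast] using h
  refine hf0 (b.ext fun i => ?_)
  refine Fin.lastCases hlast (fun i => ?_) i
  exact congrFun hz i

/-- The vectors of the moment curve are independent if the field is small. -/
theorem linearIndependent_momentVector [Finite F] {d : ℕ} (b : Module.Basis (Fin (d + 1)) F V)
    (hd : Nat.card F ≤ d) : LinearIndependent F (momentVector b) := by
  have := Fintype.ofFinite F
  rw [Fintype.linearIndependent_iff]
  intro c hc
  have hcoord : ∀ i : Fin (d + 1),
      c none * (if i = Fin.last d then 1 else 0) + ∑ s, c (some s) * s ^ (i : ℕ) = 0 := by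
    intro i
    have h := DFunLike.congr_fun (congrArg b.repr hc) i
    simp only [Fintype.sum_option, map_add, map_sum, map_smul, Finsupp.add_apply,
      Finsupp.finsetSum_apply, Finsupp.smul_apply, repr_momentVector_none,
      repr_momentVector_some, smul_eq_mul, map_zero, Finsupp.zero_apply] at h
    exact h
  let e : Fin (Fintype.card F) ≃ F := (Fintype.equivFin F).symm
  -- The first `q ≤ d` coordinates do not see the point at infinity and form a square Vandermonde
  -- system.
  have hz : (fun j => c (some (e j))) = 0 := by
    refine Matrix.eq_zero_of_forall_pow_sum_mul_pow_eq_zero (f := e) e.injective fun i => ?_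
    rw [e.sum_comp fun s => c (some s) * s ^ (i : ℕ)]
    have hi : (i : ℕ) < d := i.2.trans_le (Nat.card_eq_fintype_card (α := F) ▸ hd)
    have h := hcoord ⟨i, by omega⟩
    rw [if_neg (by simp [Fin.ext_iff, hi.ne]), mul_zero, zero_add] at h
    exact h
  have hsome : ∀ s, c (some s) = 0 := fun s => by
    simpa using congrFun hz (e.symm s)
  rintro (_ | s)
  · simpa [hsome] using hcoord (Fin.last d)
  · exact hsome s

theorem isIndependentTuple_range {ι : Type*} {f : ι → ℙ F V}
    (hf : Projectivization.Independent f) :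
    IsIndependentTuple (Nat.card ι) (Set.range f) := by
  have hli := Projectivization.independent_iff.1 hf
  have hinj : Function.Injective f := Function.Injective.of_comp hli.injective
  refine ⟨?_, ?_⟩
  · rw [← Nat.card_coe_set_eq, Nat.card_congr (Equiv.ofInjective f hinj)]
  · rw [Projectivization.independent_iff]
    have h := hli.comp _ (Equiv.ofInjective f hinj).symm.injective
    convert h using 1
    funext P
    simp only [Function.comp_apply, Equiv.apply_ofInjective_symm]

theorem isIndependentTuple_momentCurve [Finite F] {d : ℕ} (b : Module.Basis (Fin (d + 1)) F V)
    (hd : Nat.card F ≤ d) : IsIndependentTuple (Nat.card F + 1) (momentCurve b) := by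
  rw [← Finite.card_option]
  exact isIndependentTuple_range (Projectivization.Independent.mk _ (momentVector_ne_zero b)
    (linearIndependent_momentVector b hd))

end RationalCurves

/-! ### Points of a line. -/

section Points

variable {F V : Type*} [Field F] [AddCommGroup V] [Module F V]

theorem mk_mem_pointsOf {W : Submodule F V} {v : V} (hv : v ≠ 0) :
    Projectivization.mk F v hv ∈ pointsOf W ↔ v ∈ W := by
  rw [pointsOf, Set.mem_ofPred_eq, Projectivization.submodule_mk,
    Submodule.span_singleton_le_iff_mem]

/-- The points of a line on two distinct points. -/
theorem pointsOf_span_pair {a b : V} (ha : a ≠ 0) (hb : ∀ s : F, s • a - b ≠ 0) :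
    pointsOf (Submodule.span F {a, b}) = {P | P = Projectivization.mk F a ha ∨
      ∃ s, P = Projectivization.mk F (s • a - b) (hb s)} := by
  ext P
  induction P with | h v hv =>
  rw [mk_mem_pointsOf, Submodule.mem_span_pair]
  simp only [Set.mem_ofPred_eq, Projectivization.mk_eq_mk_iff']
  constructor
  · rintro ⟨x, y, rfl⟩
    by_cases hy : y = 0
    · exact Or.inl ⟨x, by simp [hy]⟩
    · refine Or.inr ⟨-(x / y), -y, ?_⟩
      rw [smul_sub, smul_smul, neg_mul_neg, mul_div_cancel₀ _ hy, neg_smul, sub_neg_eq_add]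
  · rintro (⟨x, rfl⟩ | ⟨s, x, rfl⟩)
    · exact ⟨x, 0, by simp⟩
    · exact ⟨x * s, -x, by rw [smul_sub, smul_smul, neg_smul, sub_eq_add_neg]⟩

end Points

/-! ### Subfields of a finite field. -/

section Subfields

variable {F L : Type*} [Field F] [Finite F] [Field L] [Algebra F L] [FiniteDimensional F L]

/-- In a finite field an element lies in every subfield whose degree is a multiple of its own. -/
theorem mem_of_finrank_adjoin_dvd (M : IntermediateField F L) {x : L}
    (h : Module.finrank F (IntermediateField.adjoin F {x}) ∣ Module.finrank F M) : x ∈ M := by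
  have : Finite L := Module.finite_of_finite F
  have := Fintype.ofFinite M
  have := Fintype.ofFinite (IntermediateField.adjoin F {x})
  have hN : 1 < Nat.card M := Finite.one_lt_card
  -- The order of `M` is a power of the order of `F(x)`, so this is an iterated Frobenius of `F(x)`.
  have hx : x ^ Nat.card M = x := by
    obtain ⟨n, hn⟩ := h
    have h1 := FiniteField.pow_card_pow n
      (⟨x, IntermediateField.mem_adjoin_simple_self F x⟩ : IntermediateField.adjoin F {x})
    rw [← Nat.card_eq_fintype_card, Module.natCard_eq_pow_finrank (K := F), ← pow_mul, ← hn,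
      ← Module.natCard_eq_pow_finrank (K := F)] at h1
    exact congrArg Subtype.val h1
  let p : Polynomial L := Polynomial.X ^ Nat.card M - Polynomial.X
  have hp : p ≠ 0 := FiniteField.X_pow_card_sub_X_ne_zero L hN
  have hsub : (M : Set L) ⊆ p.rootSet L := by
    intro y hy
    rw [Polynomial.mem_rootSet]
    refine ⟨hp, ?_⟩
    have h1 : y ^ Nat.card M = y := by
      have := congrArg Subtype.val (FiniteField.pow_card (⟨y, hy⟩ : M))
      rwa [← Nat.card_eq_fintype_card] at this
    simp [p, h1, -Nat.card_eq_fintype_card]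
  have heq : (M : Set L) = p.rootSet L := by
    -- `M` already has as many elements as the degree of `p` allows roots.
    refine Set.eq_of_subset_of_ncard_le hsub ?_ (Set.toFinite _)
    calc _ ≤ p.natDegree := p.ncard_rootSet_le L
      _ = Nat.card M := FiniteField.X_pow_card_sub_X_natDegree_eq L hN
      _ = _ := Nat.card_coe_set_eq (M : Set L)
  have : x ∈ p.rootSet L := by
    rw [Polynomial.mem_rootSet]
    exact ⟨hp, by simp [p, hx, -Nat.card_eq_fintype_card]⟩
  rwa [← heq] at this

/-- In an extension of finite fields of degree `2 ^ (k + 1)`, an element outside the subfield of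
index two is a generator. -/
theorem adjoin_eq_top_of_notMem {k : ℕ} (hL : Module.finrank F L = 2 ^ (k + 1))
    {M : IntermediateField F L} (hM : Module.finrank F M = 2 ^ k) {x : L} (hx : x ∉ M) :
    IntermediateField.adjoin F {x} = ⊤ := by
  have hdvd : Module.finrank F (IntermediateField.adjoin F {x}) ∣ 2 ^ (k + 1) :=
    hL ▸ Dvd.intro _ (Module.finrank_mul_finrank F (IntermediateField.adjoin F {x}) L)
  obtain ⟨j, hj, hjx⟩ := (Nat.dvd_prime_pow Nat.prime_two).1 hdvd
  have hjk : j = k + 1 := by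
    by_contra hne
    refine hx (mem_of_finrank_adjoin_dvd M ?_)
    rw [hjx, hM]
    exact pow_dvd_pow 2 (by omega)
  refine IntermediateField.eq_of_le_of_finrank_eq le_top ?_
  rw [hjx, hjk, IntermediateField.finrank_top', hL]

end Subfields

/-! ### Inverting scattered lines. -/

section Inversion

variable {F L : Type*} [Field F] [Field L] [Algebra F L]

/-- The coefficients of `minpolyDiv F θ` are a basis of `L` if `θ` generates `L`. -/
theorem exists_basis_coeff_minpolyDiv [FiniteDimensional F L] {d : ℕ}
    (hL : Module.finrank F L = d + 1) {θ : L} (hθ : IntermediateField.adjoin F {θ} = ⊤) :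
    ∃ c : Module.Basis (Fin (d + 1)) F L, ∀ i, c i = (minpolyDiv F θ).coeff i := by
  have hint : IsIntegral F θ := IsIntegral.of_finite F θ
  have hdeg : (minpoly F θ).natDegree = d + 1 := by
    rw [← IntermediateField.adjoin.finrank hint, hθ, IntermediateField.finrank_top', hL]
  have hlt : (minpolyDiv F θ).natDegree < d + 1 := hdeg ▸ natDegree_minpolyDiv_lt hint
  have htop : ⊤ ≤ Submodule.span F
      (Set.range fun i : Fin (d + 1) => (minpolyDiv F θ).coeff i) := by
    have h : Algebra.adjoin F {θ} = ⊤ := by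
      rw [← IntermediateField.adjoin_simple_toSubalgebra_of_isAlgebraic hint.isAlgebraic, hθ,
        IntermediateField.top_toSubalgebra]
    rw [← Algebra.top_toSubmodule, ← h, ← span_coeff_minpolyDiv hint, Submodule.span_le]
    rintro _ ⟨i, rfl⟩
    by_cases hi : i < d + 1
    · exact Submodule.subset_span ⟨⟨i, hi⟩, rfl⟩
    · rw [Polynomial.coeff_eq_zero_of_natDegree_lt (by omega)]
      exact Submodule.zero_mem _
  exact ⟨basisOfTopLeSpanOfCardEqFinrank _ htop (by simp [hL]), fun i => by simp⟩

/-- The inverse of a line through `a` and `θ a`, where `θ` generates `L`, is a moment curve. -/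
theorem exists_inversion_image_eq_momentCurve [FiniteDimensional F L] {d : ℕ} (hd : 0 < d)
    (hL : Module.finrank F L = d + 1) {a b : L} (ha : a ≠ 0)
    (hab : IntermediateField.adjoin F {b / a} = ⊤) :
    ∃ c : Module.Basis (Fin (d + 1)) F L,
      inversion '' pointsOf (Submodule.span F {a, b}) = momentCurve c := by
  set θ := b / a with hθ
  have hint : IsIntegral F θ := IsIntegral.of_finite F θ
  have hdeg : (minpoly F θ).natDegree = d + 1 := by
    rw [← IntermediateField.adjoin.finrank hint, hab, IntermediateField.finrank_top', hL]
  have hdiv : (minpolyDiv F θ).natDegree = d := by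
    have := natDegree_minpolyDiv_succ hint
    omega
  -- Otherwise `θ ∈ F`, so `L = F`, against `0 < d`.
  have hb : ∀ s : F, s • a - b ≠ 0 := by
    intro s hs
    have hθs : θ = algebraMap F L s := by
      rw [hθ, div_eq_iff ha, ← Algebra.smul_def, sub_eq_zero.1 hs]
    have h := IntermediateField.finrank_top' (F := F) (E := L)
    rw [← hab, hθs, IntermediateField.adjoin_simple_eq_bot_iff.2 (algebraMap_mem _ s),
      IntermediateField.finrank_bot] at h
    omega
  obtain ⟨c₀, hc₀⟩ := exists_basis_coeff_minpolyDiv hL hab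
  let c := c₀.map ((LinearEquiv.smulOfNeZero L L a⁻¹ (inv_ne_zero ha)).restrictScalars F)
  have hc : ∀ i, c i = a⁻¹ * (minpolyDiv F θ).coeff i := fun i => by simp [c, hc₀]
  -- The quotient `f / (X - θ)` is monic of degree `d`, so infinity corresponds to the point `F a`.
  have hnone : momentVector c none = a⁻¹ := by
    have h1 : (minpolyDiv F θ).coeff d = 1 := by
      have := minpolyDiv_monic hint
      rwa [Polynomial.Monic, Polynomial.leadingCoeff, hdiv] at this
    rw [momentVector, Option.elim, hc, Fin.val_last, h1, mul_one]
  have hsome : ∀ s : F, momentVector c (some s) = (minpoly F θ).eval s • (s • a - b)⁻¹ := by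
    intro s
    have h1 : momentVector c (some s) = a⁻¹ * (minpolyDiv F θ).eval (algebraMap F L s) := by
      rw [Polynomial.eval_eq_sum_range' (n := d + 1) (by omega), ← Fin.sum_univ_eq_sum_range
        (fun i => (minpolyDiv F θ).coeff i * algebraMap F L s ^ i), Finset.mul_sum]
      simp only [momentVector, Option.elim]
      refine Finset.sum_congr rfl fun i _ => ?_
      rw [hc, Algebra.smul_def, map_pow]
      ring
    have h2 := congrArg (Polynomial.eval (algebraMap F L s)) (minpolyDiv_spec F θ)
    rw [Polynomial.eval_mul, Polynomial.eval_sub, Polynomial.eval_X, Polynomial.eval_C,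
      Polynomial.eval_map_algebraMap, Polynomial.aeval_algebraMap_apply,
      Polynomial.coe_aeval_eq_eval] at h2
    rw [h1, Algebra.smul_def, ← h2, eq_mul_inv_iff_mul_eq₀ (hb s), Algebra.smul_def, hθ]
    field_simp
  have hmk : ∀ s : F, Projectivization.mk F _ (momentVector_ne_zero c (some s)) =
      Projectivization.mk F (s • a - b)⁻¹ (inv_ne_zero (hb s)) := fun s =>
    (Projectivization.mk_eq_mk_iff' F _ _ _ _).2 ⟨_, (hsome s).symm⟩
  refine ⟨c, ?_⟩
  rw [pointsOf_span_pair ha hb]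
  ext P
  constructor
  · rintro ⟨_, rfl | ⟨s, rfl⟩, rfl⟩
    · exact ⟨none, by simp only [hnone, inversion_mk]⟩
    · exact ⟨some s, by simp only [hmk, inversion_mk]⟩
  · rintro ⟨_ | s, rfl⟩
    · exact ⟨_, Or.inl rfl, by simp only [hnone, inversion_mk]⟩
    · exact ⟨_, Or.inr ⟨s, rfl⟩, by simp only [hmk, inversion_mk]⟩

theorem inversion_involutive : Function.Involutive (inversion : ℙ F L → ℙ F L) := by
  intro P
  induction P with | h v hv =>
  simp only [inversion_mk, inv_inv]

theorem isPartition_inversionImage {S : Set (Set (ℙ F L))} (hS : Setoid.IsPartition S) :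
    Setoid.IsPartition (inversionImage S) := by
  refine ⟨?_, fun P => ?_⟩
  · rintro ⟨l, hl, hl0⟩
    rw [Set.image_eq_empty] at hl0
    exact hS.1 (hl0 ▸ hl)
  · obtain ⟨l, ⟨hl, hPl⟩, huniq⟩ := hS.2 (inversion P)
    refine ⟨inversion '' l, ⟨⟨l, hl, rfl⟩, _, hPl, inversion_involutive P⟩, ?_⟩
    rintro _ ⟨⟨l', hl', rfl⟩, Q, hQ, rfl⟩
    rw [inversion_involutive Q] at huniq
    rw [huniq l' ⟨hl', hQ⟩]

/-- The direction of a scattered line is not in `M`. -/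
theorem div_notMem_of_isScattered {M : IntermediateField F L} {W : Submodule F L}
    (hW : IsScattered (pointsOf W) (desarguesianSpread M)) {a b : L} (ha : a ∈ W) (hb : b ∈ W)
    (hab : LinearIndependent F ![a, b]) : b / a ∉ M := by
  intro hm
  have ha0 : a ≠ 0 := hab.ne_zero 0
  have hb0 : b ≠ 0 := hab.ne_zero 1
  -- Both `a` and `b = (b / a) a` would lie in the spread element `M a`.
  have h := @hW _ ⟨a, ha0, rfl⟩ (Projectivization.mk F a ha0)
    ⟨(mk_mem_pointsOf ha0).2 ha, (mk_mem_pointsOf ha0).2 (Submodule.mem_span_singleton_self a)⟩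
    (Projectivization.mk F b hb0)
    ⟨(mk_mem_pointsOf hb0).2 hb, (mk_mem_pointsOf hb0).2 (Submodule.mem_span_singleton.2
      ⟨⟨b / a, hm⟩, div_mul_cancel₀ b ha0⟩)⟩
  rw [Projectivization.mk_eq_mk_iff'] at h
  obtain ⟨s, hs⟩ := h
  have := (LinearIndependent.pair_iff.1 hab) 1 (-s) (by rw [one_smul, neg_smul, hs, add_neg_cancel])
  exact one_ne_zero this.1

theorem exists_momentCurve_of_isScattered [Finite F] {k d : ℕ} (hk : 0 < k) (hd : d + 1 = 2 ^ k)
    (hL : Module.finrank F L = 2 ^ k) {M : IntermediateField F L}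
    (hM : Module.finrank F M = 2 ^ (k - 1)) {l : Set (ℙ F L)} (hl : IsLine l)
    (hs : IsScattered l (desarguesianSpread M)) :
    ∃ c : Module.Basis (Fin (d + 1)) F L, inversion '' l = momentCurve c := by
  have : FiniteDimensional F L := Module.finite_of_finrank_pos (by rw [hL]; positivity)
  obtain ⟨W, hW, rfl⟩ := hl
  let e := Module.finBasisOfFinrankEq F W hW
  have he : ![(e 0 : L), (e 1 : L)] = W.subtype ∘ e := by
    ext i
    fin_cases i <;> rfl
  have hspan : W = Submodule.span F {(e 0 : L), (e 1 : L)} := by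
    have h := congrArg (Submodule.map W.subtype) e.span_eq
    rw [Submodule.map_span, Submodule.map_top, Submodule.range_subtype, ← Set.range_comp, ← he,
      Matrix.range_cons, Matrix.range_cons, Matrix.range_empty, Set.union_empty,
      Set.singleton_union] at h
    exact h.symm
  have hli : LinearIndependent F ![(e 0 : L), (e 1 : L)] :=
    he ▸ e.linearIndependent.map' W.subtype W.ker_subtype
  have hm := div_notMem_of_isScattered hs (e 0).2 (e 1).2 hli
  obtain ⟨k, rfl⟩ := Nat.exists_eq_succ_of_ne_zero hk.ne'
  have hd0 : 0 < d := by
    have : 2 ≤ 2 ^ (k + 1) := Nat.le_self_pow (by omega) 2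
    omega
  rw [hspan]
  exact exists_inversion_image_eq_momentCurve hd0 (hL.trans hd.symm) (hli.ne_zero 0)
    (adjoin_eq_top_of_notMem hL hM hm)

/-- The line spread of a scattered spread of subspaces. -/
theorem IsScatteredSpread.isLineSpread {M : IntermediateField F L} {S : Set (Submodule F L)}
    (hS : IsScatteredSpread M S) : IsLineSpread (pointsOf '' S) := by
  obtain ⟨h2, -, hp⟩ := hS
  refine ⟨?_, ?_, ?_⟩
  · rintro _ ⟨W, hW, rfl⟩
    exact ⟨W, h2 W hW, rfl⟩
  · rintro ⟨W, hW, hW0⟩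
    have hne : W ≠ ⊥ := by
      rintro rfl
      simpa using h2 _ hW
    obtain ⟨v, hv, hv0⟩ := W.exists_mem_ne_zero_of_ne_bot hne
    have : Projectivization.mk F v hv0 ∈ pointsOf W := (mk_mem_pointsOf hv0).2 hv
    rw [hW0] at this
    exact this
  · intro P
    induction P with | h v hv =>
    obtain ⟨W, ⟨hW, hvW⟩, huniq⟩ := hp v hv
    refine ⟨pointsOf W, ⟨⟨W, hW, rfl⟩, (mk_mem_pointsOf hv).2 hvW⟩, ?_⟩
    rintro _ ⟨⟨W', hW', rfl⟩, hvW'⟩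
    rw [huniq W' ⟨hW', (mk_mem_pointsOf hv).1 hvW'⟩]

theorem IsScatteredSpread.isScattered {M : IntermediateField F L} {S : Set (Submodule F L)}
    (hS : IsScatteredSpread M S) {l : Set (ℙ F L)} (hl : l ∈ pointsOf '' S) :
    IsScattered l (desarguesianSpread M) := by
  obtain ⟨W, hW, rfl⟩ := hl
  rintro _ ⟨z, hz, rfl⟩ P hP Q hQ
  induction P with | h a ha =>
  induction Q with | h b hb =>
  obtain ⟨haW, haz⟩ := hP
  obtain ⟨hbW, hbz⟩ := hQ
  rw [mk_mem_pointsOf] at haW haz hbW hbz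
  obtain ⟨m, rfl⟩ := Submodule.mem_span_singleton.1 haz
  obtain ⟨n, rfl⟩ := Submodule.mem_span_singleton.1 hbz
  have hn : n ≠ 0 := by
    rintro rfl
    simp at hb
  -- Two points of `M z` differ by a factor in `M`, which scatteredness forces into `F`.
  have hmn : ((m / n : M) : L) * (n • z) = m • z := by
    change (m / n) • n • z = m • z
    rw [smul_smul, div_mul_cancel₀ _ hn]
  obtain ⟨s, hs⟩ := IntermediateField.mem_bot.1
    (hS.2.1 W hW _ hbW hb (m / n : M) (m / n : M).2 (hmn ▸ haW))
  rw [Projectivization.mk_eq_mk_iff']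
  exact ⟨s, by rw [Algebra.smul_def, hs, hmn]⟩

end Inversion

end FieldInversion

theorem mainTheorem1 {F L : Type*} [Field F] [Finite F] [Field L] [Algebra F L]
    (q k : ℕ) (hq : Nat.card F = q) (hk : 1 < k) (hL : Module.finrank F L = 2 ^ k)
    (M : IntermediateField F L) (hM : Module.finrank F M = 2 ^ (k - 1)) :
    (∃ S : Set (Set (ℙ F L)), FieldInversion.IsLineSpread S ∧
      ∀ l ∈ S, FieldInversion.IsScattered l (FieldInversion.desarguesianSpread M)) ∧
    ∀ S : Set (Set (ℙ F L)), FieldInversion.IsLineSpread S →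
      (∀ l ∈ S, FieldInversion.IsScattered l (FieldInversion.desarguesianSpread M)) →
      Setoid.IsPartition (FieldInversion.inversionImage S) ∧
      (2 ^ k - 1 ≤ q → ∀ C ∈ FieldInversion.inversionImage S,
        FieldInversion.IsNRCOfDegree (2 ^ k - 1) C) ∧
      (q < 2 ^ k - 1 → ∀ C ∈ FieldInversion.inversionImage S,
        FieldInversion.IsIndependentTuple (q + 1) C) := by
  subst hq
  have hd : 2 ^ k - 1 + 1 = 2 ^ k := Nat.sub_add_cancel Nat.one_le_two_pow
  refine ⟨?_, fun S hS hSs => ⟨FieldInversion.isPartition_inversionImage hS.2, ?_, ?_⟩⟩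
  · obtain ⟨S, hS⟩ := FieldInversion.exists_isScatteredSpread (k - 1)
      (by rw [hL, Nat.sub_add_cancel hk.le]) M hM
    exact ⟨_, hS.isLineSpread, fun l hl => hS.isScattered hl⟩
  · rintro hq _ ⟨l, hl, rfl⟩
    obtain ⟨c, hc⟩ := FieldInversion.exists_momentCurve_of_isScattered (by omega) hd hL hM
      (hS.1 l hl) (hSs l hl)
    beta_reduce
    rw [hc]
    exact FieldInversion.isNRCOfDegree_of_pointSpan_eq_top (hL.trans hd.symm)
      (FieldInversion.isRationalCurve_momentCurve c)
      (FieldInversion.pointSpan_momentCurve_eq_top c hq)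
  · rintro hq _ ⟨l, hl, rfl⟩
    obtain ⟨c, hc⟩ := FieldInversion.exists_momentCurve_of_isScattered (by omega) hd hL hM
      (hS.1 l hl) (hSs l hl)
    beta_reduce
    rw [hc]
    exact FieldInversion.isIndependentTuple_momentCurve c hq.le
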